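/- **Setting.** Let $T>0$ and let $\{u^\varepsilon\}_{\varepsilon\in S}$, $S\subset(0,\infty)$, be a family of approximate solutions of the incompressible Euler equations in $\mathbb{R}^3$ over $[0,T]$. That is, the $u^\varepsilon(\cdot,t)\in L^1_{loc}(\mathbb{R}^3)$, $t\in[0,T]$, are measurable in $(x,t)$ and satisfy $\operatorname{div}u^\varepsilon(\cdot,t)=0$ in the sense of distributions. They are bounded, uniformly in $\varepsilon$, in $L^\infty([0,T];L^2_{loc}(\mathbb{R}^3))$ and in $\mathrm{Lip}([0,T];H^{-L}_{loc}(\mathbb{R}^3))$ for some $L$. Finally, for every $\Phi\in C_c^\infty([0,T)\times\mathbb{R}^3;\mathbb{R}^3)$ with $\operatorname{div}\Phi=0$, $$\int_0^T\!\!\int_{\mathbb{R}^3}\Phi_t\cdot u^\varepsilon+(D\Phi\,u^\varepsilon)\cdot u^\varepsilon\,dx\,dt+\int_{\mathbb{R}^3}\Phi(x,0)\cdot u^\varepsilon(x,0)\,dx\longrightarrow0\quad\text{as }\varepsilon\to0,\ \varepsilon\in S.$$ For $R_0\in(0,\tfrac12)$, an open set $\Omega\subset\mathbb{R}^3$ and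 $f\in L^1_{loc}(\Omega)$ put $$\|f\|_{\mathbb{V}^{6/5,2}(\Omega)}=\sup\Big(\sum_j\frac1{R_j}\Big(\int_{B_j}|f(x)|\,dx\Big)^2\Big)^{1/2},$$ the supremum being over all collections of mutually disjoint balls $B_j\subset\Omega$ with radii $0<R_j\le R_0$. The space $\mathbb{V}^{6/5,2}(\Omega)$ consists of the $f\in L^1_{loc}(\Omega)$ for which this is finite. **Theorem 4.2.** Assume that for all $\varepsilon\in S$ and $t\in[0,T]$ the distributional vorticity $\omega^\varepsilon(\cdot,t)=\nabla\times u^\varepsilon(\cdot,t)$ is a locally integrable function with compact support. Assume also the local alignment condition: there are constants $K_0\ge0$, $\delta>0$ and $\theta<1$, independent of $\varepsilon$ and $t$, such that $\xi^\varepsilon=\omega^\varepsilon/|\omega^\varepsilon|$ satisfies, for all $\varepsilon\in S$, $t\in[0,T]$ and almost all $(x,y)$, $$|\xi^\varepsilon(x,t)-\xi^\varepsilon(y,t)|\le\sqrt2\,\theta\quad\text{whenever }|x-y|\le\delta\text{ and }|\omega^\varepsilon(x,t)|,|\omega^\varepsilon(y,t)|>K_0.$$ Fix $R_0\in(0,\tfrac12)$.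 Then: 1. For every bounded open $\Omega\subset\mathbb{R}^3$ there is a constant $C$ such that $\omega^\varepsilon(\cdot,t)\in\mathbb{V}^{6/5,2}(\Omega)$ and $\|\omega^\varepsilon(\cdot,t)\|_{\mathbb{V}^{6/5,2}(\Omega)}\le C$ for all $\varepsilon\in S$ and $t\in[0,T]$. 2. If, moreover, all the $\omega^\varepsilon(\cdot,t)$, $\varepsilon\in S$, $t\in[0,T]$, are supported in one compact set, then there is a constant $C$ with which the conclusion of part 1 holds simultaneously for all open $\Omega\subset\mathbb{R}^3$, including $\Omega=\mathbb{R}^3$. -/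

import Mathlib

open MeasureTheory Set Filter Topology
open scoped ENNReal NNReal

noncomputable section

/-- Euclidean space of dimension `N`. -/
abbrev Eu (N : ℕ) : Type := EuclideanSpace ℝ (Fin N)

/-! ### The spaces `V^{pq}` -/

/-- `BallPacking R₀ Ω` is the set of all collections of mutually disjoint balls contained in `Ω`
with radii at most `R₀`; a ball is recorded as the pair (centre, radius). -/
def BallPacking {N : ℕ} (R₀ : ℝ) (Ω : Set (Eu N)) : Set (Set (Eu N × ℝ)) :=
  {𝓑 | (∀ B ∈ 𝓑, 0 < B.2 ∧ B.2 ≤ R₀ ∧ Metric.ball B.1 B.2 ⊆ Ω) ∧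
    𝓑.PairwiseDisjoint (fun B => Metric.ball B.1 B.2)}

/-- The `V^{pq}(Ω)` norm, `1 ≤ p ≤ q < ∞`: the supremum, over all collections of disjoint balls
`B_j ⊆ Ω` of radii `R_j ≤ R₀`, of `(∑_j (R_j^{-N/p'} ∫_{B_j} |f|)^q)^{1/q}`, where
`1/p' = 1 - 1/p`. It is `∞` when these sums are not bounded. -/
def vNorm {N : ℕ} {F : Type*} [NormedAddCommGroup F] (p q R₀ : ℝ) (Ω : Set (Eu N))
    (f : Eu N → F) : ℝ≥0∞ :=
  ⨆ 𝓑 ∈ BallPacking R₀ Ω,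
    (∑' B : 𝓑, (ENNReal.ofReal (B.1.2 ^ (-((N : ℝ) * (1 - 1 / p)))) *
      ∫⁻ x in Metric.ball B.1.1 B.1.2, ‖f x‖ₑ) ^ q) ^ (1 / q)

/-- Membership in `V^{pq}(Ω)`: local integrability in `Ω` together with a finite norm. -/
def MemV {N : ℕ} {F : Type*} [NormedAddCommGroup F] (p q R₀ : ℝ) (Ω : Set (Eu N))
    (f : Eu N → F) : Prop :=
  LocallyIntegrableOn f Ω ∧ vNorm p q R₀ Ω f < ∞

/-! ### Differential operators on smooth fields and their weak versions -/

/-- Test fields: smooth with compact support. -/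
def IsTest {N : ℕ} {F : Type*} [NormedAddCommGroup F] [NormedSpace ℝ F] (φ : Eu N → F) : Prop :=
  ContDiff ℝ (⊤ : ℕ∞) φ ∧ HasCompactSupport φ

/-- The partial derivative `∂_j φ_i` at `x`. -/
def pderiv {N : ℕ} (φ : Eu N → Eu N) (j i : Fin N) (x : Eu N) : ℝ :=
  (fderiv ℝ φ x (EuclideanSpace.single j 1)) i

/-- The divergence of a differentiable vector field. -/
def divergence {N : ℕ} (φ : Eu N → Eu N) (x : Eu N) : ℝ :=
  ∑ i, pderiv φ i i x

/-- The curl of a differentiable vector field in three dimensions. -/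
def curl (φ : Eu 3 → Eu 3) (x : Eu 3) : Eu 3 :=
  !₂[pderiv φ 1 2 x - pderiv φ 2 1 x,
     pderiv φ 2 0 x - pderiv φ 0 2 x,
     pderiv φ 0 1 x - pderiv φ 1 0 x]

/-- `div v = 0` in the sense of distributions. -/
def IsWeaklyDivFree {N : ℕ} (v : Eu N → Eu N) : Prop :=
  ∀ φ : Eu N → ℝ, IsTest φ → ∫ x, inner ℝ (v x) (gradient φ x) = 0

/-- The locally integrable field `w` is the vorticity `∇ × v` of `v`, in the sense of
distributions. -/
def IsVorticity (v w : Eu 3 → Eu 3) : Prop :=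
  LocallyIntegrable w ∧
    ∀ φ : Eu 3 → Eu 3, IsTest φ → ∫ x, inner ℝ (w x) (φ x) = ∫ x, inner ℝ (v x) (curl φ x)

/-- The Sobolev norm `‖φ‖_{H^L}` of a test field, `L` a natural number. -/
def sobolevNorm {N : ℕ} (L : ℕ) (φ : Eu N → Eu N) : ℝ :=
  Real.sqrt (∑ k ∈ Finset.range (L + 1), ∫ x, ‖iteratedFDeriv ℝ k φ x‖ ^ 2)

/-! ### Approximate solutions of the incompressible Euler equations -/

/-- Space-time test fields: smooth fields with compact support in `[0,T) × ℝ^N` (given as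
restrictions of smooth fields on `ℝ × ℝ^N`), divergence-free in space. -/
structure IsEulerTest {N : ℕ} (T : ℝ) (Φ : ℝ → Eu N → Eu N) : Prop where
  smooth : ContDiff ℝ (⊤ : ℕ∞) (fun z : ℝ × Eu N => Φ z.1 z.2)
  compactSupport : HasCompactSupport (fun z : ℝ × Eu N => Φ z.1 z.2)
  support_lt : tsupport (fun z : ℝ × Eu N => Φ z.1 z.2) ⊆ Iio T ×ˢ univ
  divFree : ∀ t ∈ Icc 0 T, ∀ x, divergence (Φ t) x = 0

/-- The weak form of the Euler equations on `[0,T]`, tested against `Φ`: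
`∫_0^T ∫ Φ_t · v + (DΦ v) · v dx dt + ∫ Φ(x,0) · v(x,0) dx`. -/
def eulerDefect {N : ℕ} (T : ℝ) (v Φ : ℝ → Eu N → Eu N) : ℝ :=
  (∫ t in Icc 0 T, ∫ x,
      (inner ℝ (deriv (fun s => Φ s x) t) (v t x) +
        inner ℝ (fderiv ℝ (Φ t) x (v t x)) (v t x))) +
    ∫ x, inner ℝ (Φ 0 x) (v 0 x)

/-- A family `u^ε`, `ε ∈ S`, of approximate solutions of the incompressible Euler equations in
`ℝ^N` over `[0,T]`. Here `u ε t x` is the velocity `u^ε(x,t)`, and `S` is a set of positive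
parameters, so that discrete sequences `ε_k → 0` and continuous families are both included. -/
structure IsApproxEuler {N : ℕ} (T : ℝ) (S : Set ℝ) (u : ℝ → ℝ → Eu N → Eu N) : Prop where
  pos : S ⊆ Ioi 0
  measurable : ∀ ε ∈ S, AEStronglyMeasurable (fun z : ℝ × Eu N => u ε z.1 z.2)
    ((volume.restrict (Icc 0 T)).prod volume)
  locallyIntegrable : ∀ ε ∈ S, ∀ t ∈ Icc 0 T, LocallyIntegrable (u ε t)
  divFree : ∀ ε ∈ S, ∀ t ∈ Icc 0 T, IsWeaklyDivFree (u ε t)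
  /-- uniform bound in `L^∞([0,T]; L²_loc)` -/
  energy : ∀ K : Set (Eu N), IsCompact K → ∃ C : ℝ≥0, ∀ ε ∈ S,
    ∀ᵐ t ∂(volume.restrict (Icc 0 T)), eLpNorm (u ε t) 2 (volume.restrict K) ≤ C
  /-- uniform bound in `Lip([0,T]; H^{-L}_loc)`, the norm of `H^{-L}` being taken by duality -/
  lipschitz : ∃ L : ℕ, ∀ K : Set (Eu N), IsCompact K → ∃ C : ℝ≥0, ∀ ε ∈ S,
    ∀ s ∈ Icc 0 T, ∀ t ∈ Icc 0 T, ∀ φ : Eu N → Eu N, IsTest φ → tsupport φ ⊆ K →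
      |∫ x, inner ℝ (u ε t x - u ε s x) (φ x)| ≤ C * |t - s| * sobolevNorm L φ
  /-- approximate consistency with the Euler equations -/
  consistent : ∀ Φ : ℝ → Eu N → Eu N, IsEulerTest T Φ →
    Tendsto (fun ε => eulerDefect T (u ε) Φ) (𝓝[S] 0) (𝓝 0)

/-! ### Support and local alignment of the vorticity -/

/-- The class of `f` vanishes (almost everywhere) outside `K`. -/
def SupportedIn {N : ℕ} (f : Eu N → Eu N) (K : Set (Eu N)) : Prop :=
  ∀ᵐ x, x ∉ K → f x = 0

/-- The direction `v/|v|` of a non-zero vector. -/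
def direction {N : ℕ} (v : Eu N) : Eu N := ‖v‖⁻¹ • v

/-- The local alignment condition: there are constants `K₀ ≥ 0`, `δ > 0`, `θ < 1`, common to all
`ε ∈ S` and `t ∈ [0,T]`, such that `|ξ^ε(x,t) - ξ^ε(y,t)| ≤ √2 θ` whenever `|x - y| ≤ δ` and both
`|ω^ε(x,t)|` and `|ω^ε(y,t)|` exceed `K₀`, where `ξ^ε = ω^ε/|ω^ε|`. Vorticities being defined up
to null sets, this is asked for almost every pair `(x,y)`. -/
def LocallyAligned {N : ℕ} (T : ℝ) (S : Set ℝ) (ω : ℝ → ℝ → Eu N → Eu N) : Prop :=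
  ∃ K₀ δ θ : ℝ, 0 ≤ K₀ ∧ 0 < δ ∧ θ < 1 ∧ ∀ ε ∈ S, ∀ t ∈ Icc 0 T, ∀ᵐ z : Eu N × Eu N,
    ‖z.1 - z.2‖ ≤ δ → K₀ < ‖ω ε t z.1‖ → K₀ < ‖ω ε t z.2‖ →
      ‖direction (ω ε t z.1) - direction (ω ε t z.2)‖ ≤ Real.sqrt 2 * θ

end

/-!
Testing the vorticity against a bump field `φ = χ((x - c) / R) e` gives
`∫ ω · φ = ∫ u · curl φ`, which is at most a multiple of `R⁻¹ ∫ |u|` over the double of the ball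
`B` with centre `c` and radius `R`. If `B` is small compared with the alignment distance `δ`, then
the directions of the large vorticity on the double of `B` lie in a cone of opening less than a
right angle around one of them, `e` say, so that `∫ ω · φ` controls `∫_B |ω|` up to `O(R³)`
(`exists_setIntegral_norm_le_of_aligned`). Hence `R⁻¹ (∫_B |ω|)²` is at most a multiple of
`|B| m² + O(R⁵)`, where `m` is the mean of `|u|` over the double of `B`.

The doubles of disjoint balls of different sizes may overlap with unbounded multiplicity, so the
sum over a packing is not bounded by `∫ |u|²` trivially. It is bounded because the `L²` maximal
inequality holds for means over such balls, in the form of a Carleson embedding: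
`sum_measure_ball_mul_sq_le_lintegral_sq`, proved by Vitali's covering lemma and the layer-cake
formula. No cancellation is used, and neither the Biot-Savart law nor any global bound on `u` is
needed.

The energy bound holds at almost every time. The quantities to be bounded are finite sums of
squares of pairings of `u` with fixed test fields, continuous in time by the Lipschitz bound in
`H^{-L}`, so their bound extends to every time (`IsApproxEuler.exists_sum_sq_le`). Balls of radius
comparable to `δ` or larger are handled by the resulting local `L¹` bound on the vorticity. If all
vorticities live in one compact set, only balls near it contribute, whatever `Ω` is.
-/

/-! ### The Carleson embedding for dilated disjoint balls -/

section Carleson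

variable {E ι : Type*} [NormedAddCommGroup E] [NormedSpace ℝ E] [FiniteDimensional ℝ E]
  [MeasurableSpace E] [BorelSpace E] (μ : Measure E) [μ.IsAddHaarMeasure]

/-- The weak-type step: if `g` has mean at least `a` on the doubles of finitely many disjoint
balls, then these balls have total measure at most a multiple of `a⁻¹ ∫ g`. The doubles may
overlap; Vitali's lemma selects disjoint ones whose fivefold dilates cover all of them. -/
theorem mul_sum_measure_ball_le_lintegral {F : Finset ι} {c : ι → E} {r : ι → ℝ}
    (hr : ∀ i ∈ F, 0 < r i)
    (hF : (F : Set ι).PairwiseDisjoint fun i => Metric.ball (c i) (r i))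
    {g : E → ℝ≥0∞} {a : ℝ≥0∞}
    (ha : ∀ i ∈ F, a * μ (Metric.closedBall (c i) (2 * r i)) ≤
      ∫⁻ x in Metric.closedBall (c i) (2 * r i), g x ∂μ) :
    a * ∑ i ∈ F, μ (Metric.ball (c i) (r i)) ≤
      ENNReal.ofReal (5 ^ Module.finrank ℝ E) * ∫⁻ x, g x ∂μ := by
  classical
  obtain ⟨B, hB⟩ : ∃ B, ∀ i ∈ (F : Set ι), 2 * r i ≤ B := by
    obtain ⟨B, hB⟩ := (F.image fun i => 2 * r i).bddAbove
    exact ⟨B, fun i hi => hB (by simpa using ⟨i, hi, rfl⟩)⟩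
  obtain ⟨u, huF, hu, hcov⟩ := Vitali.exists_disjoint_subfamily_covering_enlargement_closedBall
    (F : Set ι) c (fun i => 2 * r i) B hB 5 (by norm_num)
  have hufin : u.Finite := F.finite_toSet.subset huF
  lift u to Finset ι using hufin
  have huF' : u ⊆ F := by exact_mod_cast huF
  have hsub : (⋃ i ∈ F, Metric.ball (c i) (r i)) ⊆
      ⋃ i ∈ u, Metric.closedBall (c i) (5 * (2 * r i)) := by
    refine iUnion₂_subset fun i hi => ?_
    obtain ⟨b, hb, hib⟩ := hcov i hi
    refine Subset.trans ?_ (hib.trans (subset_biUnion_of_mem (u := fun i =>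
      Metric.closedBall (c i) (5 * (2 * r i))) hb))
    exact (Metric.ball_subset_closedBall).trans
      (Metric.closedBall_subset_closedBall (by linarith [hr i hi]))
  have hscale : ∀ i ∈ u, μ (Metric.closedBall (c i) (5 * (2 * r i))) =
      ENNReal.ofReal (5 ^ Module.finrank ℝ E) * μ (Metric.closedBall (c i) (2 * r i)) := by
    intro i hi
    have := hr i (huF' hi)
    rw [Measure.addHaar_closedBall_mul μ (c i) (by norm_num) (by positivity),
      Measure.addHaar_closedBall_center μ (c i)]
  calc a * ∑ i ∈ F, μ (Metric.ball (c i) (r i))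
      = a * μ (⋃ i ∈ F, Metric.ball (c i) (r i)) := by
        rw [measure_biUnion_finset hF fun i _ => Metric.isOpen_ball.measurableSet]
    _ ≤ a * ∑ i ∈ u, μ (Metric.closedBall (c i) (5 * (2 * r i))) := by
        gcongr
        exact (measure_mono hsub).trans (measure_biUnion_finset_le _ _)
    _ = ENNReal.ofReal (5 ^ Module.finrank ℝ E) *
          ∑ i ∈ u, a * μ (Metric.closedBall (c i) (2 * r i)) := by
        rw [Finset.sum_congr rfl hscale, ← Finset.mul_sum, ← Finset.mul_sum]
        ring
    _ ≤ ENNReal.ofReal (5 ^ Module.finrank ℝ E) *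
          ∑ i ∈ u, ∫⁻ x in Metric.closedBall (c i) (2 * r i), g x ∂μ := by
        gcongr with i hi
        exact ha i (huF' hi)
    _ ≤ _ := by
        gcongr
        rw [← lintegral_biUnion_finset hu fun i _ => Metric.isClosed_closedBall.measurableSet]
        exact setLIntegral_le_lintegral _ _

/-- **Carleson embedding.** If the balls `B i` are disjoint and `m i` is at most the mean of `f`
over the double of `B i`, then `∑ |B i| (m i)²` is bounded by a multiple of `∫ f²`, although the
doubles may overlap with unbounded multiplicity. This is the `L²` maximal inequality, sampled on
the balls: at height `t` the weak-type step is applied to the part of `f` above `t / 2`, and the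
result is integrated in `t`. -/
theorem sum_measure_ball_mul_sq_le_lintegral_sq {F : Finset ι} {c : ι → E} {r m : ι → ℝ}
    (hr : ∀ i ∈ F, 0 < r i) (hm : ∀ i, 0 ≤ m i)
    (hF : (F : Set ι).PairwiseDisjoint fun i => Metric.ball (c i) (r i))
    {f : E → ℝ≥0∞} (hf : Measurable f)
    (hmf : ∀ i ∈ F, ENNReal.ofReal (m i) * μ (Metric.closedBall (c i) (2 * r i)) ≤
      ∫⁻ x in Metric.closedBall (c i) (2 * r i), f x ∂μ) :
    ∑ i ∈ F, μ (Metric.ball (c i) (r i)) * ENNReal.ofReal (m i ^ 2) ≤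
      ENNReal.ofReal (8 * 5 ^ Module.finrank ℝ E) * ∫⁻ x, f x ^ 2 ∂μ := by
  classical
  -- the layer-cake formula is applied to the atomic measure with mass `|B i|` at `i`
  let _ : MeasurableSpace ι := ⊤
  set ν : Measure ι := ∑ i ∈ F, μ (Metric.ball (c i) (r i)) • Measure.dirac i with hν
  have hlhs : ∑ i ∈ F, μ (Metric.ball (c i) (r i)) * ENNReal.ofReal (m i ^ 2) =
      ∫⁻ i, ENNReal.ofReal (m i ^ (2 : ℝ)) ∂ν := by
    rw [hν, lintegral_finsetSum_measure]
    refine Finset.sum_congr rfl fun i _ => ?_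
    rw [lintegral_smul_measure, lintegral_dirac' _ measurable_from_top, smul_eq_mul]
    norm_num
  have hνset : ∀ t : ℝ, ν {i | t < m i} =
      ∑ i ∈ F.filter (fun i => t < m i), μ (Metric.ball (c i) (r i)) := by
    intro t
    rw [hν, Measure.finsetSum_apply, Finset.sum_filter]
    refine Finset.sum_congr rfl fun i _ => ?_
    rw [Measure.smul_apply, Measure.dirac_apply' _ MeasurableSpace.measurableSet_top]
    by_cases h : t < m i <;> simp [h]
  have hlevel : ∀ t ∈ Ioi (0 : ℝ), ν {i | t < m i} * ENNReal.ofReal (t ^ ((2 : ℝ) - 1)) ≤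
      2 * (ENNReal.ofReal (5 ^ Module.finrank ℝ E) *
        ∫⁻ x, {y | ENNReal.ofReal (t / 2) < f y}.indicator f x ∂μ) := by
    intro t ht
    have ht : 0 < t := ht
    have hhalf : ENNReal.ofReal t = ENNReal.ofReal (t / 2) + ENNReal.ofReal (t / 2) := by
      rw [← ENNReal.ofReal_add (by positivity) (by positivity)]; ring_nf
    have hexp : t ^ ((2 : ℝ) - 1) = t := by norm_num
    have key := mul_sum_measure_ball_le_lintegral μ (F := F.filter fun i => t < m i) (c := c)
      (r := r) (g := {y | ENNReal.ofReal (t / 2) < f y}.indicator f) (a := ENNReal.ofReal (t / 2))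
      (fun i hi => hr i (Finset.mem_filter.1 hi).1)
      (hF.subset (Finset.coe_subset.2 (Finset.filter_subset _ F))) (by
        intro i hi
        obtain ⟨hiF, hti⟩ := Finset.mem_filter.1 hi
        set D := Metric.closedBall (c i) (2 * r i)
        have hD : ENNReal.ofReal (t / 2) * μ D ≠ ∞ :=
          ENNReal.mul_ne_top ENNReal.ofReal_ne_top
            (isCompact_closedBall (c i) (2 * r i)).measure_lt_top.ne
        refine (ENNReal.add_le_add_iff_right hD).1 ?_
        calc ENNReal.ofReal (t / 2) * μ D + ENNReal.ofReal (t / 2) * μ D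
            = ENNReal.ofReal t * μ D := by rw [hhalf, add_mul]
          _ ≤ ENNReal.ofReal (m i) * μ D := by gcongr
          _ ≤ ∫⁻ x in D, f x ∂μ := hmf i hiF
          _ ≤ ∫⁻ x in D, ({y | ENNReal.ofReal (t / 2) < f y}.indicator f x +
                ENNReal.ofReal (t / 2)) ∂μ := by
              refine lintegral_mono fun x => ?_
              by_cases h : ENNReal.ofReal (t / 2) < f x
              · simp [indicator, h]
              · simpa [indicator, h] using not_lt.1 h
          _ = _ := by
              rw [lintegral_add_right _ measurable_const, setLIntegral_const])
    rw [hνset, hexp, hhalf, ← two_mul, mul_comm, mul_assoc]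
    gcongr
  have hswap : ∫⁻ t in Ioi (0 : ℝ), ∫⁻ x, {y | ENNReal.ofReal (t / 2) < f y}.indicator f x ∂μ ≤
      ∫⁻ x, 2 * f x ^ 2 ∂μ := by
    have hmeas : MeasurableSet {z : ℝ × E | ENNReal.ofReal (z.1 / 2) < f z.2} :=
      measurableSet_lt (by fun_prop) (hf.comp measurable_snd)
    have hunc : Measurable (Function.uncurry fun (t : ℝ) (x : E) =>
        {y | ENNReal.ofReal (t / 2) < f y}.indicator f x) :=
      (hf.comp measurable_snd).indicator hmeas
    rw [lintegral_lintegral_swap hunc.aemeasurable]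
    refine lintegral_mono fun x => ?_
    by_cases hx : f x = ∞
    · simp [hx]
    have : ∀ t ∈ Ioi (0 : ℝ), {y | ENNReal.ofReal (t / 2) < f y}.indicator f x ≤
        (Iio (2 * (f x).toReal)).indicator (fun _ => f x) t := by
      intro t ht
      by_cases h : ENNReal.ofReal (t / 2) < f x
      · have h' := (ENNReal.ofReal_lt_iff_lt_toReal (by linarith [mem_Ioi.1 ht]) hx).1 h
        have : t ∈ Iio (2 * (f x).toReal) := by rw [mem_Iio]; linarith
        rw [indicator_of_mem this]
        exact indicator_le_self _ _ _
      · simp [indicator, h]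
    calc _ ≤ ∫⁻ t in Ioi (0 : ℝ), (Iio (2 * (f x).toReal)).indicator (fun _ => f x) t :=
          setLIntegral_mono' measurableSet_Ioi this
      _ = 2 * f x ^ 2 := by
          rw [lintegral_indicator measurableSet_Iio, Measure.restrict_restrict measurableSet_Iio,
            setLIntegral_const, inter_comm, Ioi_inter_Iio, Real.volume_Ioo, sub_zero,
            ENNReal.ofReal_mul (by norm_num), ENNReal.ofReal_toReal hx]
          norm_num
          ring
  rw [hlhs, lintegral_rpow_eq_lintegral_meas_lt_mul ν (Eventually.of_forall hm)
    measurable_from_top.aemeasurable (by norm_num)]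
  have h2 : ENNReal.ofReal 2 = 2 := by norm_num
  calc ENNReal.ofReal 2 * ∫⁻ t in Ioi (0 : ℝ), ν {i | t < m i} *
          ENNReal.ofReal (t ^ ((2 : ℝ) - 1))
      ≤ 2 * ∫⁻ t in Ioi (0 : ℝ), 2 * (ENNReal.ofReal (5 ^ Module.finrank ℝ E) *
        ∫⁻ x, {y | ENNReal.ofReal (t / 2) < f y}.indicator f x ∂μ) := by
        rw [h2]
        exact mul_le_mul_right (setLIntegral_mono' measurableSet_Ioi hlevel) _
    _ = 2 * (2 * (ENNReal.ofReal (5 ^ Module.finrank ℝ E) * ∫⁻ t in Ioi (0 : ℝ),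
        ∫⁻ x, {y | ENNReal.ofReal (t / 2) < f y}.indicator f x ∂μ)) := by
        rw [lintegral_const_mul' _ _ (by norm_num),
          lintegral_const_mul' _ _ ENNReal.ofReal_ne_top]
    _ ≤ 2 * (2 * (ENNReal.ofReal (5 ^ Module.finrank ℝ E) * ∫⁻ x, 2 * f x ^ 2 ∂μ)) := by
        gcongr
    _ = _ := by
        rw [lintegral_const_mul' _ _ (by norm_num), ENNReal.ofReal_mul (by norm_num)]
        norm_num
        ring

end Carleson

/-! ### Rescaled bump fields and their curl -/

/-- A fixed smooth cutoff, equal to `1` on the unit ball and supported in its double. -/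
noncomputable def unitBump (N : ℕ) : ContDiffBump (0 : Eu N) := ⟨1, 2, one_pos, one_lt_two⟩

/-- The test field `χ((x - c) / R) e`, where `χ` is `unitBump` and the ball with centre `c` and
radius `R` is recorded as the pair `B = (c, R)`. -/
noncomputable def bumpField {N : ℕ} (B : Eu N × ℝ) (e : Eu N) (x : Eu N) : Eu N :=
  unitBump N (B.2⁻¹ • (x - B.1)) • e

theorem unitBump_eq_one_of_mem_ball {N : ℕ} {c x : Eu N} {R : ℝ} (hR : 0 < R)
    (hx : x ∈ Metric.ball c R) : unitBump N (R⁻¹ • (x - c)) = 1 := by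
  refine (unitBump N).one_of_mem_closedBall ?_
  have : ‖x - c‖ < R := mem_ball_iff_norm.1 hx
  rw [mem_closedBall_zero_iff, norm_smul, norm_inv, Real.norm_of_nonneg hR.le]
  change R⁻¹ * ‖x - c‖ ≤ 1
  rw [inv_mul_le_iff₀ hR]
  linarith

theorem unitBump_eq_zero_of_notMem_ball {N : ℕ} {c x : Eu N} {R : ℝ} (hR : 0 < R)
    (hx : x ∉ Metric.ball c (2 * R)) : unitBump N (R⁻¹ • (x - c)) = 0 := by
  refine (unitBump N).zero_of_le_dist ?_
  have : 2 * R ≤ ‖x - c‖ := by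
    rw [mem_ball_iff_norm] at hx
    exact not_lt.1 hx
  rw [dist_zero_right, norm_smul, norm_inv, Real.norm_of_nonneg hR.le]
  change 2 ≤ R⁻¹ * ‖x - c‖
  rw [le_inv_mul_iff₀ hR]
  linarith

theorem tsupport_bumpField_subset {N : ℕ} {B : Eu N × ℝ} (hB : 0 < B.2) (e : Eu N) :
    tsupport (bumpField B e) ⊆ Metric.closedBall B.1 (2 * B.2) := by
  refine closure_minimal (fun x hx => ?_) Metric.isClosed_closedBall
  by_contra h
  refine hx ?_
  rw [bumpField, unitBump_eq_zero_of_notMem_ball hB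
    fun h' => h (Metric.ball_subset_closedBall h'), zero_smul]

theorem isTest_bumpField {N : ℕ} {B : Eu N × ℝ} (hB : 0 < B.2) (e : Eu N) :
    IsTest (bumpField B e) := by
  refine ⟨?_, (isCompact_closedBall _ _).of_isClosed_subset (isClosed_tsupport _)
    (tsupport_bumpField_subset hB e)⟩
  exact ((unitBump N).contDiff.comp (by fun_prop)).smul contDiff_const

theorem exists_norm_fderiv_bumpField_le (N : ℕ) : ∃ M : ℝ, 0 ≤ M ∧ ∀ (B : Eu N × ℝ) (e x : Eu N),
    0 < B.2 → ‖e‖ ≤ 1 → ‖fderiv ℝ (bumpField B e) x‖ ≤ M * B.2⁻¹ := by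
  have hχ : ContDiff ℝ 1 (unitBump N) := (unitBump N).contDiff
  obtain ⟨M, hM⟩ := (hχ.continuous_fderiv one_ne_zero).bounded_above_of_compact_support
    (HasCompactSupport.fderiv ℝ (unitBump N).hasCompactSupport)
  have hM0 : 0 ≤ M := (norm_nonneg _).trans (hM 0)
  refine ⟨M, hM0, fun B e x hB he => ?_⟩
  have h1 : HasFDerivAt (fun x : Eu N => B.2⁻¹ • (x - B.1))
      (B.2⁻¹ • ContinuousLinearMap.id ℝ (Eu N)) x := ((hasFDerivAt_id x).sub_const B.1).const_smul B.2⁻¹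
  have h2 := ((hχ.differentiable one_ne_zero _).hasFDerivAt.comp x h1).smul_const e
  have h3 : fderiv ℝ (bumpField B e) x = _ := h2.fderiv
  rw [h3, ContinuousLinearMap.norm_smulRight_apply, ContinuousLinearMap.comp_smul,
    ContinuousLinearMap.comp_id, norm_smul, norm_inv, Real.norm_of_nonneg hB.le]
  calc _ ≤ B.2⁻¹ * M * 1 := by
        have := hM (B.2⁻¹ • (x - B.1))
        gcongr
    _ = M * B.2⁻¹ := by ring

theorem abs_pderiv_le {N : ℕ} (φ : Eu N → Eu N) (j i : Fin N) (x : Eu N) :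
    |pderiv φ j i x| ≤ ‖fderiv ℝ φ x‖ := by
  calc |pderiv φ j i x| ≤ ‖fderiv ℝ φ x (EuclideanSpace.single j 1)‖ :=
        PiLp.norm_apply_le (fderiv ℝ φ x (EuclideanSpace.single j 1)) i
    _ ≤ ‖fderiv ℝ φ x‖ * ‖(EuclideanSpace.single j 1 : Eu N)‖ :=
        ContinuousLinearMap.le_opNorm _ _
    _ = ‖fderiv ℝ φ x‖ := by simp

theorem norm_curl_le (φ : Eu 3 → Eu 3) (x : Eu 3) : ‖curl φ x‖ ≤ 4 * ‖fderiv ℝ φ x‖ := by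
  have h : ∀ i j k l, |pderiv φ i j x - pderiv φ k l x| ^ 2 ≤ (2 * ‖fderiv ℝ φ x‖) ^ 2 := by
    intro i j k l
    have := abs_sub (pderiv φ i j x) (pderiv φ k l x)
    have := abs_pderiv_le φ i j x
    have := abs_pderiv_le φ k l x
    gcongr
    linarith
  refine le_of_sq_le_sq ?_ (by positivity)
  rw [EuclideanSpace.norm_sq_eq, Fin.sum_univ_three]
  simp only [curl, Real.norm_eq_abs]
  simp only [Matrix.cons_val]
  nlinarith [h 1 2 2 1, h 2 0 0 2, h 0 1 1 0, sq_nonneg ‖fderiv ℝ φ x‖]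

theorem curl_eq_zero_of_notMem_tsupport {φ : Eu 3 → Eu 3} {x : Eu 3} (hx : x ∉ tsupport φ) :
    curl φ x = 0 := by
  have h := norm_curl_le φ x
  rw [fderiv_of_notMem_tsupport ℝ hx, norm_zero, mul_zero] at h
  exact norm_le_zero_iff.1 h

theorem tsupport_curl_subset (φ : Eu 3 → Eu 3) : tsupport (curl φ) ⊆ tsupport φ :=
  closure_minimal (fun _ hx => by_contra fun h => hx (curl_eq_zero_of_notMem_tsupport h))
    (isClosed_tsupport φ)

theorem IsTest.curl {φ : Eu 3 → Eu 3} (hφ : IsTest φ) : IsTest (curl φ) := by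
  refine ⟨?_, hφ.2.of_isClosed_subset (isClosed_tsupport _) (tsupport_curl_subset φ)⟩
  have hp : ∀ j i, ContDiff ℝ (⊤ : ℕ∞) (pderiv φ j i) := fun j i =>
    contDiff_euclidean.1 ((hφ.1.fderiv_right (m := (⊤ : ℕ∞)) (by norm_cast)).clm_apply
      contDiff_const) i
  refine contDiff_euclidean.2 fun i => ?_
  fin_cases i
  · exact (hp 1 2).sub (hp 2 1)
  · exact (hp 2 0).sub (hp 0 2)
  · exact (hp 0 1).sub (hp 1 0)

theorem locallyIntegrable_norm {N : ℕ} {v : Eu N → Eu N} (hv : LocallyIntegrable v) :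
    LocallyIntegrable fun x => ‖v x‖ := fun x => (hv x).norm

theorem IsTest.integrable_inner {N : ℕ} {v φ : Eu N → Eu N} (hφ : IsTest φ)
    (hv : LocallyIntegrable v) : Integrable fun x => inner ℝ (v x) (φ x) := by
  have h := (locallyIntegrable_norm hv).integrable_smul_left_of_hasCompactSupport hφ.1.continuous.norm hφ.2.norm
  refine h.mono' (hv.aestronglyMeasurable.inner hφ.1.continuous.aestronglyMeasurable)
    (Eventually.of_forall fun x => ?_)
  rw [smul_eq_mul, mul_comm]
  exact norm_inner_le_norm _ _

/-! ### The velocity tested against curls of bump fields -/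

theorem volume_real_ball {N : ℕ} (c : Eu N) {R : ℝ} (hR : 0 < R) :
    volume.real (Metric.ball c R) = R ^ N * volume.real (Metric.ball (0 : Eu N) 1) := by
  simp only [measureReal_def, Measure.addHaar_ball_of_pos volume c hR, ENNReal.toReal_mul,
    finrank_euclideanSpace_fin, ENNReal.toReal_ofReal (pow_nonneg hR.le N)]

theorem volume_real_closedBall {N : ℕ} (c : Eu N) {R : ℝ} (hR : 0 < R) :
    volume.real (Metric.closedBall c R) = R ^ N * volume.real (Metric.ball (0 : Eu N) 1) := by
  simp only [measureReal_def, Measure.addHaar_closedBall volume c hR.le, ENNReal.toReal_mul,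
    finrank_euclideanSpace_fin, ENNReal.toReal_ofReal (pow_nonneg hR.le N)]

theorem exists_abs_integral_inner_curl_bumpField_le : ∃ M : ℝ, 0 ≤ M ∧
    ∀ (B : Eu 3 × ℝ) (e : Eu 3) (v : Eu 3 → Eu 3), 0 < B.2 → ‖e‖ ≤ 1 → LocallyIntegrable v →
      |∫ x, inner ℝ (v x) (curl (bumpField B e) x)| ≤
        M * B.2⁻¹ * ∫ x in Metric.closedBall B.1 (2 * B.2), ‖v x‖ := by
  obtain ⟨M, hM0, hM⟩ := exists_norm_fderiv_bumpField_le 3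
  refine ⟨4 * M, by positivity, fun B e v hB he hv => ?_⟩
  have hint : IntegrableOn (fun x => ‖v x‖) (Metric.closedBall B.1 (2 * B.2)) :=
    (hv.integrableOn_isCompact (isCompact_closedBall _ _)).norm
  rw [← setIntegral_eq_integral_of_forall_compl_eq_zero (s := Metric.closedBall B.1 (2 * B.2)),
    ← Real.norm_eq_abs, ← integral_const_mul]
  · refine norm_integral_le_of_norm_le (hint.const_mul _) (Eventually.of_forall fun x => ?_)
    calc _ ≤ ‖v x‖ * ‖curl (bumpField B e) x‖ := norm_inner_le_norm _ _
      _ ≤ ‖v x‖ * (4 * (M * B.2⁻¹)) := by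
          have := norm_curl_le (bumpField B e) x
          have := hM B e x hB he
          gcongr
          linarith
      _ = _ := by ring
  · intro x hx
    rw [curl_eq_zero_of_notMem_tsupport fun h => hx (tsupport_bumpField_subset hB e h),
      inner_zero_right]

/-- The square sum of the velocity tested against curls of bump fields on disjoint balls is
controlled by the energy: each term is at most `|B|` times the squared mean of `|v|` over the
double of `B`, so the Carleson embedding applies. -/
theorem exists_sum_sq_integral_inner_curl_bumpField_le : ∃ C : ℝ, 0 ≤ C ∧
    ∀ (F : Finset (Eu 3 × ℝ)) (e : Eu 3 × ℝ → Eu 3) (K : Set (Eu 3)) (v : Eu 3 → Eu 3) (A : ℝ≥0),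
      (∀ B ∈ F, 0 < B.2 ∧ Metric.closedBall B.1 (2 * B.2) ⊆ K) → (∀ B ∈ F, ‖e B‖ ≤ 1) →
      (F : Set (Eu 3 × ℝ)).PairwiseDisjoint (fun B => Metric.ball B.1 B.2) →
      MeasurableSet K → LocallyIntegrable v → eLpNorm v 2 (volume.restrict K) ≤ A →
      ∑ B ∈ F, B.2⁻¹ * (∫ x, inner ℝ (v x) (curl (bumpField B (e B)) x)) ^ 2 ≤ C * A ^ 2 := by
  obtain ⟨M, hM0, hM⟩ := exists_abs_integral_inner_curl_bumpField_le
  set κ : ℝ := volume.real (Metric.ball (0 : Eu 3) 1) with hκ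
  have hκ0 : 0 < κ := 
    ENNReal.toReal_pos (Metric.measure_ball_pos volume 0 one_pos).ne' measure_ball_lt_top.ne
  refine ⟨64 * M ^ 2 * κ * (8 * 5 ^ 3), by positivity, fun F e K v A hF he hdisj hK hv hA => ?_⟩
  set m : Eu 3 × ℝ → ℝ := fun B => (∫ x in Metric.closedBall B.1 (2 * B.2), ‖v x‖) /
    volume.real (Metric.closedBall B.1 (2 * B.2)) with hm
  have hm0 : ∀ B, 0 ≤ m B := fun B => by positivity
  have hvolb : ∀ B ∈ F, volume.real (Metric.ball B.1 B.2) = B.2 ^ 3 * κ :=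
    fun B hB => volume_real_ball B.1 (hF B hB).1
  have hvolc : ∀ B ∈ F, volume.real (Metric.closedBall B.1 (2 * B.2)) = (2 * B.2) ^ 3 * κ :=
    fun B hB => volume_real_closedBall B.1 (by linarith [(hF B hB).1])
  have hterm : ∀ B ∈ F, B.2⁻¹ * (∫ x, inner ℝ (v x) (curl (bumpField B (e B)) x)) ^ 2 ≤
      64 * M ^ 2 * κ * (volume.real (Metric.ball B.1 B.2) * m B ^ 2) := by
    intro B hB
    have hR := (hF B hB).1
    have hmean : ∫ x in Metric.closedBall B.1 (2 * B.2), ‖v x‖ = m B * ((2 * B.2) ^ 3 * κ) := by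
      rw [← hvolc B hB, hm]
      refine (div_mul_cancel₀ _ ?_).symm
      rw [hvolc B hB]
      positivity
    have h := hM B (e B) v hR (he B hB) hv
    rw [hmean] at h
    calc _ ≤ B.2⁻¹ * (M * B.2⁻¹ * (m B * ((2 * B.2) ^ 3 * κ))) ^ 2 := by
          rw [← sq_abs]
          gcongr
      _ = _ := by
          rw [hvolb B hB]
          field_simp
          ring
  set v' := hv.aestronglyMeasurable.mk v
  have hvv' : v =ᵐ[volume] v' := hv.aestronglyMeasurable.ae_eq_mk
  have hv' : Measurable fun x => ‖v' x‖ₑ :=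
    hv.aestronglyMeasurable.stronglyMeasurable_mk.enorm
  have hcar := sum_measure_ball_mul_sq_le_lintegral_sq (volume : Measure (Eu 3)) (F := F)
    (c := Prod.fst) (r := Prod.snd) (m := m) (fun B hB => (hF B hB).1) hm0 hdisj
    (f := K.indicator fun x => ‖v' x‖ₑ) (hv'.indicator hK) (by
      intro B hB
      have hfin : volume (Metric.closedBall B.1 (2 * B.2)) ≠ ∞ := measure_closedBall_lt_top.ne
      have hpos : volume.real (Metric.closedBall B.1 (2 * B.2)) ≠ 0 := by
        have := (hF B hB).1
        rw [hvolc B hB]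
        positivity
      have hint : IntegrableOn v (Metric.closedBall B.1 (2 * B.2)) :=
        hv.integrableOn_isCompact (isCompact_closedBall _ _)
      calc _ = ENNReal.ofReal (∫ x in Metric.closedBall B.1 (2 * B.2), ‖v x‖) := by
            rw [← ENNReal.ofReal_toReal hfin, ← ENNReal.ofReal_mul (hm0 B), hm]
            congr 1
            exact div_mul_cancel₀ _ hpos
        _ = ∫⁻ x in Metric.closedBall B.1 (2 * B.2), ‖v x‖ₑ :=
            ofReal_integral_norm_eq_lintegral_enorm hint
        _ ≤ _ := by
            refine (setLIntegral_mono_ae' Metric.isClosed_closedBall.measurableSet ?_)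
            filter_upwards [hvv'] with x hx hxB
            rw [indicator_of_mem ((hF B hB).2 hxB), hx])
  have henergy : ∫⁻ x, (K.indicator (fun x => ‖v' x‖ₑ) x) ^ 2 ≤ ENNReal.ofReal (A ^ 2) := by
    calc ∫⁻ x, (K.indicator (fun x => ‖v' x‖ₑ) x) ^ 2 = ∫⁻ x in K, ‖v x‖ₑ ^ 2 := by
          rw [← lintegral_indicator hK]
          refine lintegral_congr_ae ?_
          filter_upwards [hvv'] with x hx
          by_cases h : x ∈ K <;> simp [h, hx]
      _ = eLpNorm v 2 (volume.restrict K) ^ 2 := by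
          have := eLpNorm_nnreal_pow_eq_lintegral (f := v) (μ := volume.restrict K)
            (p := 2) two_ne_zero
          simpa using this.symm
      _ ≤ (A : ℝ≥0∞) ^ 2 := by gcongr
      _ = ENNReal.ofReal (A ^ 2) := by
          rw [ENNReal.ofReal_pow A.coe_nonneg, ENNReal.ofReal_coe_nnreal]
  have hsum : ∑ B ∈ F, volume.real (Metric.ball B.1 B.2) * m B ^ 2 ≤ 8 * 5 ^ 3 * (A : ℝ) ^ 2 := by
    refine (ENNReal.ofReal_le_ofReal_iff (by positivity)).1 ?_
    rw [ENNReal.ofReal_sum_of_nonneg fun B _ => by positivity,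
      ENNReal.ofReal_mul (by positivity)]
    calc _ = ∑ B ∈ F, volume (Metric.ball B.1 B.2) * ENNReal.ofReal (m B ^ 2) := by
          refine Finset.sum_congr rfl fun B _ => ?_
          rw [ENNReal.ofReal_mul measureReal_nonneg, ofReal_measureReal measure_ball_lt_top.ne]
      _ ≤ _ := hcar
      _ ≤ _ := by
          rw [finrank_euclideanSpace_fin]
          gcongr
  calc _ ≤ ∑ B ∈ F, 64 * M ^ 2 * κ * (volume.real (Metric.ball B.1 B.2) * m B ^ 2) :=
        Finset.sum_le_sum hterm
    _ ≤ 64 * M ^ 2 * κ * (8 * 5 ^ 3 * (A : ℝ) ^ 2) := by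
        rw [← Finset.mul_sum]
        gcongr
    _ = _ := by ring

/-! ### The energy bound at every time -/

/-- The square sums of the velocity against curls of bump fields are bounded uniformly in `ε` and
at *every* time. The energy bound gives this at almost every time only; but the pairing of the
velocity with a fixed test field is Lipschitz in time, and a finite sum passes to the limit. -/
theorem IsApproxEuler.exists_sum_sq_le {T : ℝ} (hT : 0 < T) {S : Set ℝ} {u : ℝ → ℝ → Eu 3 → Eu 3}
    (hu : IsApproxEuler T S u) {K : Set (Eu 3)} (hK : IsCompact K) :
    ∃ C : ℝ, 0 ≤ C ∧ ∀ ε ∈ S, ∀ t ∈ Icc 0 T, ∀ (F : Finset (Eu 3 × ℝ)) (e : Eu 3 × ℝ → Eu 3),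
      (∀ B ∈ F, 0 < B.2 ∧ Metric.closedBall B.1 (2 * B.2) ⊆ K) → (∀ B ∈ F, ‖e B‖ ≤ 1) →
      (F : Set (Eu 3 × ℝ)).PairwiseDisjoint (fun B => Metric.ball B.1 B.2) →
      ∑ B ∈ F, B.2⁻¹ * (∫ x, inner ℝ (u ε t x) (curl (bumpField B (e B)) x)) ^ 2 ≤ C := by
  obtain ⟨C, hC0, hC⟩ := exists_sum_sq_integral_inner_curl_bumpField_le
  obtain ⟨A, hA⟩ := hu.energy K hK
  obtain ⟨L, hL⟩ := hu.lipschitz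
  obtain ⟨D, hD⟩ := hL K hK
  refine ⟨C * A ^ 2, by positivity, fun ε hε t ht F e hF he hdisj => ?_⟩
  have hdense : Dense {s | s ∈ Icc 0 T → eLpNorm (u ε s) 2 (volume.restrict K) ≤ A} :=
    Measure.dense_of_ae ((ae_restrict_iff' measurableSet_Icc).1 (hA ε hε))
  set G := Ioo 0 T ∩ {s | s ∈ Icc 0 T → eLpNorm (u ε s) 2 (volume.restrict K) ≤ A} with hG
  have htG : t ∈ closure G := by
    have h := closure_mono (hdense.open_subset_closure_inter (isOpen_Ioo (a := 0) (b := T)))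
    rw [closure_closure, closure_Ioo hT.ne] at h
    exact h ht
  have := mem_closure_iff_nhdsWithin_neBot.1 htG
  have hlim : ∀ B ∈ F, Tendsto (fun s => ∫ x, inner ℝ (u ε s x) (curl (bumpField B (e B)) x))
      (𝓝[G] t) (𝓝 (∫ x, inner ℝ (u ε t x) (curl (bumpField B (e B)) x))) := by
    intro B hB
    have htest := (isTest_bumpField (hF B hB).1 (e B)).curl
    have hsupp : tsupport (curl (bumpField B (e B))) ⊆ K :=
      (tsupport_curl_subset _).trans
        ((tsupport_bumpField_subset (hF B hB).1 (e B)).trans (hF B hB).2)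
    set N := sobolevNorm L (curl (bumpField B (e B)))
    rw [tendsto_iff_dist_tendsto_zero]
    refine squeeze_zero' (g := fun s => D * |s - t| * N) (Eventually.of_forall fun s => dist_nonneg)
      ?_ ?_
    · filter_upwards [self_mem_nhdsWithin] with s hs
      have hs' : s ∈ Icc 0 T := Ioo_subset_Icc_self hs.1
      rw [Real.dist_eq, ← integral_sub (htest.integrable_inner (hu.locallyIntegrable ε hε s hs'))
        (htest.integrable_inner (hu.locallyIntegrable ε hε t ht))]
      simp_rw [← inner_sub_left]
      exact hD ε hε t ht s hs' _ htest hsupp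
    · have hcont : Continuous fun s : ℝ => (D : ℝ) * |s - t| * N := by fun_prop
      have h := (hcont.tendsto t).mono_left (nhdsWithin_le_nhds (s := G))
      simpa using h
  refine le_of_tendsto (tendsto_finsetSum F fun B hB => ((hlim B hB).pow 2).const_mul _) ?_
  filter_upwards [self_mem_nhdsWithin] with s hs
  have hs' : s ∈ Icc 0 T := Ioo_subset_Icc_self hs.1
  exact hC F e K (u ε s) A hF he hdisj hK.measurableSet (hu.locallyIntegrable ε hε s hs')
    (hs.2 hs')

/-! ### Alignment on small balls -/

/-- On a ball of diameter at most `δ` an aligned field lies, where it is large, in a cone around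
one of its own directions `e`, so that `|w|` is controlled by `w · e`: if `|ξ - e| ≤ √2 θ` for unit
vectors, then `ξ · e ≥ 1 - θ²`. The maximum with `0` covers negative `θ`. -/
theorem exists_norm_le_inner_of_aligned {N : ℕ} {w : Eu N → Eu N} {K₀ δ θ : ℝ} (hK₀ : 0 ≤ K₀)
    (hw : ∀ᵐ z : Eu N × Eu N, ‖z.1 - z.2‖ ≤ δ → K₀ < ‖w z.1‖ → K₀ < ‖w z.2‖ →
      ‖direction (w z.1) - direction (w z.2)‖ ≤ Real.sqrt 2 * θ)
    {c : Eu N} {r : ℝ} (hr : 2 * r ≤ δ) :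
    ∃ e : Eu N, ‖e‖ ≤ 1 ∧ ∀ᵐ y, y ∈ Metric.ball c r →
      (1 - max θ 0 ^ 2) * ‖w y‖ ≤ inner ℝ (w y) e + 2 * K₀ := by
  have hc : 1 - max θ 0 ^ 2 ≤ 1 := by linarith [sq_nonneg (max θ 0)]
  have hsmall : ∀ y e, ‖e‖ ≤ 1 → ‖w y‖ ≤ K₀ →
      (1 - max θ 0 ^ 2) * ‖w y‖ ≤ inner ℝ (w y) e + 2 * K₀ := by
    intro y e he hy
    have h1 := (abs_le.1 (abs_real_inner_le_norm (w y) e)).1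
    have h2 := mul_le_mul_of_nonneg_left he (norm_nonneg (w y))
    have h3 := mul_le_mul_of_nonneg_right hc (norm_nonneg (w y))
    linarith
  by_cases hex : ∀ᵐ x, x ∈ Metric.ball c r → ‖w x‖ ≤ K₀
  · refine ⟨0, by simp, ?_⟩
    filter_upwards [hex] with y hy hyB using hsmall y 0 (by simp) (hy hyB)
  have hfreq : ∃ᵐ x, ¬ (x ∈ Metric.ball c r → ‖w x‖ ≤ K₀) := not_eventually.1 hex
  obtain ⟨x, hx, hxy⟩ := (hfreq.and_eventually (Measure.ae_ae_of_ae_prod hw)).exists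
  push Not at hx
  obtain ⟨hxB, hxK⟩ := hx
  have hunit : ∀ y, K₀ < ‖w y‖ → ‖direction (w y)‖ = 1 := by
    intro y hy
    rw [direction, norm_smul, norm_inv, norm_norm, inv_mul_cancel₀ (hK₀.trans_lt hy).ne']
  refine ⟨direction (w x), (hunit x hxK).le, ?_⟩
  filter_upwards [hxy] with y hy hyB
  by_cases hyK : ‖w y‖ ≤ K₀
  · exact hsmall y _ (hunit x hxK).le hyK
  push Not at hyK
  have hdist : ‖x - y‖ ≤ δ := by
    rw [← dist_eq_norm]
    have := dist_triangle_right x y c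
    linarith [Metric.mem_ball.1 hxB, Metric.mem_ball.1 hyB]
  have h1 : ‖direction (w y) - direction (w x)‖ ≤ Real.sqrt 2 * max θ 0 := by
    rw [norm_sub_rev]
    exact (hy hdist hxK hyK).trans (by gcongr; exact le_max_left _ _)
  have h2 : ‖direction (w y) - direction (w x)‖ ^ 2 ≤ 2 * max θ 0 ^ 2 := by
    calc _ ≤ (Real.sqrt 2 * max θ 0) ^ 2 := by gcongr
      _ = _ := by rw [mul_pow, Real.sq_sqrt (by norm_num)]
  rw [norm_sub_sq_real, hunit x hxK, hunit y hyK] at h2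
  have h3 : inner ℝ (w y) (direction (w x)) =
      ‖w y‖ * inner ℝ (direction (w y)) (direction (w x)) := by
    rw [direction, direction, real_inner_smul_left, mul_inv_cancel_left₀ (hK₀.trans_lt hyK).ne']
  rw [h3]
  have h4 := mul_le_mul_of_nonneg_left
    (show 1 - max θ 0 ^ 2 ≤ inner ℝ (direction (w y)) (direction (w x)) by linarith)
    (norm_nonneg (w y))
  linarith

theorem exists_setIntegral_norm_le_of_aligned {N : ℕ} {w : Eu N → Eu N} {K₀ δ θ : ℝ}
    (hK₀ : 0 ≤ K₀) (hθ : θ < 1)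
    (hw : ∀ᵐ z : Eu N × Eu N, ‖z.1 - z.2‖ ≤ δ → K₀ < ‖w z.1‖ → K₀ < ‖w z.2‖ →
      ‖direction (w z.1) - direction (w z.2)‖ ≤ Real.sqrt 2 * θ)
    (hwl : LocallyIntegrable w) {B : Eu N × ℝ} (hB : 0 < B.2) (hBδ : 4 * B.2 ≤ δ) :
    ∃ e : Eu N, ‖e‖ ≤ 1 ∧ (1 - max θ 0 ^ 2) * ∫ x in Metric.ball B.1 B.2, ‖w x‖ ≤
      (∫ x, inner ℝ (w x) (bumpField B e x)) +
        2 * K₀ * volume.real (Metric.ball B.1 (2 * B.2)) := by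
  obtain ⟨e, he, h⟩ := exists_norm_le_inner_of_aligned hK₀ hw (c := B.1) (r := 2 * B.2)
    (by linarith)
  refine ⟨e, he, ?_⟩
  have hc : 0 ≤ 1 - max θ 0 ^ 2 := by
    have h0 : 0 ≤ max θ 0 := le_max_right _ _
    have h1 : max θ 0 < 1 := max_lt hθ one_pos
    nlinarith
  have hIw : IntegrableOn (fun x => (1 - max θ 0 ^ 2) * ‖w x‖) (Metric.ball B.1 B.2) :=
    ((hwl.integrableOn_isCompact (isCompact_closedBall B.1 B.2)).mono_set
      Metric.ball_subset_closedBall).norm.const_mul _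
  have hIφ := (isTest_bumpField hB e).integrable_inner hwl
  have hIc : IntegrableOn (fun _ : Eu N => 2 * K₀) (Metric.ball B.1 (2 * B.2)) :=
    integrableOn_const measure_ball_lt_top.ne
  rw [← integral_const_mul, ← integral_indicator Metric.isOpen_ball.measurableSet]
  have hconst : 2 * K₀ * volume.real (Metric.ball B.1 (2 * B.2)) =
      ∫ x, (Metric.ball B.1 (2 * B.2)).indicator (fun _ => 2 * K₀) x := by
    rw [integral_indicator Metric.isOpen_ball.measurableSet, setIntegral_const, smul_eq_mul,
      mul_comm]
  rw [hconst, ← integral_add hIφ (hIc.integrable_indicator Metric.isOpen_ball.measurableSet)]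
  refine integral_mono_ae (hIw.integrable_indicator Metric.isOpen_ball.measurableSet)
    (hIφ.add (hIc.integrable_indicator Metric.isOpen_ball.measurableSet)) ?_
  filter_upwards [h] with x hx
  have hsub : Metric.ball B.1 B.2 ⊆ Metric.ball B.1 (2 * B.2) :=
    Metric.ball_subset_ball (by linarith)
  by_cases hx2 : x ∈ Metric.ball B.1 (2 * B.2)
  · have hx' := hx hx2
    by_cases hx1 : x ∈ Metric.ball B.1 B.2
    · simpa [hx1, hx2, bumpField, unitBump_eq_one_of_mem_ball hB hx1] using hx'
    · have h0 : 0 ≤ inner ℝ (w x) e + 2 * K₀ := le_trans (by positivity) hx'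
      have hχ0 := (unitBump N).nonneg (x := B.2⁻¹ • (x - B.1))
      have hχ1 := (unitBump N).le_one (x := B.2⁻¹ • (x - B.1))
      simp only [indicator_of_mem hx2, indicator_of_notMem hx1, bumpField,
        real_inner_smul_right]
      nlinarith [mul_nonneg hχ0 h0, mul_nonneg (sub_nonneg.2 hχ1) hK₀]
  · have hx1 : x ∉ Metric.ball B.1 B.2 := fun h => hx2 (hsub h)
    simp [hx1, hx2, bumpField, unitBump_eq_zero_of_notMem_ball hB hx2]

/-! ### Square sums of the vorticity over disjoint balls -/

theorem sum_volume_real_ball_le {N : ℕ} {F : Finset (Eu N × ℝ)} {K : Set (Eu N)}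
    (hK : IsCompact K) (hF : ∀ B ∈ F, Metric.ball B.1 B.2 ⊆ K)
    (hdisj : (F : Set (Eu N × ℝ)).PairwiseDisjoint fun B => Metric.ball B.1 B.2) :
    ∑ B ∈ F, volume.real (Metric.ball B.1 B.2) ≤ volume.real K := by
  rw [← measureReal_biUnion_finset hdisj fun _ _ => Metric.isOpen_ball.measurableSet]
  exact measureReal_mono (iUnion₂_subset hF) hK.measure_lt_top.ne

theorem sum_setIntegral_norm_ball_le {N : ℕ} {w : Eu N → Eu N} (hw : LocallyIntegrable w)
    {F : Finset (Eu N × ℝ)} {K : Set (Eu N)} (hK : IsCompact K)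
    (hF : ∀ B ∈ F, Metric.ball B.1 B.2 ⊆ K)
    (hdisj : (F : Set (Eu N × ℝ)).PairwiseDisjoint fun B => Metric.ball B.1 B.2) :
    ∑ B ∈ F, ∫ x in Metric.ball B.1 B.2, ‖w x‖ ≤ ∫ x in K, ‖w x‖ := by
  have hint : IntegrableOn (fun x => ‖w x‖) K := (hw.integrableOn_isCompact hK).norm
  rw [← integral_biUnion_finset F (fun _ _ => Metric.isOpen_ball.measurableSet) hdisj
    fun B hB => hint.mono_set (hF B hB)]
  exact setIntegral_mono_set hint (Eventually.of_forall fun _ => norm_nonneg _)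
    (iUnion₂_subset hF).eventuallyLE

section Vorticity

variable {T : ℝ} {S : Set ℝ} {u ω : ℝ → ℝ → Eu 3 → Eu 3} {K₀ δ θ : ℝ}

/-- The square sums over disjoint balls of radius at most `δ / 4`. On such a ball the alignment
bounds `∫ |ω|` by `∫ ω · φ` with a bump field `φ`, up to `O(R³)`; the first term is the velocity
tested against `curl φ`, and the error contributes `O(R⁵)`, which is summable by volume. -/
theorem exists_sum_sq_vorticity_le_of_small (hT : 0 < T) (hu : IsApproxEuler T S u)
    (hω : ∀ ε ∈ S, ∀ t ∈ Icc 0 T, IsVorticity (u ε t) (ω ε t)) (hK₀ : 0 ≤ K₀) (hθ : θ < 1)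
    (halign : ∀ ε ∈ S, ∀ t ∈ Icc 0 T, ∀ᵐ z : Eu 3 × Eu 3,
      ‖z.1 - z.2‖ ≤ δ → K₀ < ‖ω ε t z.1‖ → K₀ < ‖ω ε t z.2‖ →
        ‖direction (ω ε t z.1) - direction (ω ε t z.2)‖ ≤ Real.sqrt 2 * θ)
    {K : Set (Eu 3)} (hK : IsCompact K) :
    ∃ C : ℝ, 0 ≤ C ∧ ∀ ε ∈ S, ∀ t ∈ Icc 0 T, ∀ F : Finset (Eu 3 × ℝ),
      (∀ B ∈ F, 0 < B.2 ∧ B.2 ≤ 1 ∧ 4 * B.2 ≤ δ ∧ Metric.closedBall B.1 (2 * B.2) ⊆ K) →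
      (F : Set (Eu 3 × ℝ)).PairwiseDisjoint (fun B => Metric.ball B.1 B.2) →
      ∑ B ∈ F, B.2⁻¹ * (∫ x in Metric.ball B.1 B.2, ‖ω ε t x‖) ^ 2 ≤ C := by
  obtain ⟨C, hC0, hC⟩ := hu.exists_sum_sq_le hT hK
  set κ : ℝ := volume.real (Metric.ball (0 : Eu 3) 1)
  set c := 1 - max θ 0 ^ 2 with hc
  have hc0 : 0 < c := by
    have h0 : 0 ≤ max θ 0 := le_max_right _ _
    have h1 : max θ 0 < 1 := max_lt hθ one_pos
    nlinarith
  refine ⟨(2 * C + 512 * K₀ ^ 2 * κ * volume.real K) / c ^ 2, by positivity,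
    fun ε hε t ht F hF hdisj => ?_⟩
  have hex : ∀ B : Eu 3 × ℝ, ∃ e : Eu 3, B ∈ F → ‖e‖ ≤ 1 ∧
      c * ∫ x in Metric.ball B.1 B.2, ‖ω ε t x‖ ≤
        (∫ x, inner ℝ (u ε t x) (curl (bumpField B e) x)) +
          2 * K₀ * volume.real (Metric.ball B.1 (2 * B.2)) := by
    intro B
    by_cases hB : B ∈ F
    · obtain ⟨h1, -, h2, -⟩ := hF B hB
      obtain ⟨e, he, h⟩ := exists_setIntegral_norm_le_of_aligned hK₀ hθ (halign ε hε t ht)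
        (hω ε hε t ht).1 h1 h2
      rw [(hω ε hε t ht).2 _ (isTest_bumpField h1 e)] at h
      exact ⟨e, fun _ => ⟨he, h⟩⟩
    · exact ⟨0, fun h => absurd h hB⟩
  choose e he using hex
  have hterm : ∀ B ∈ F, c ^ 2 * (B.2⁻¹ * (∫ x in Metric.ball B.1 B.2, ‖ω ε t x‖) ^ 2) ≤
      2 * (B.2⁻¹ * (∫ x, inner ℝ (u ε t x) (curl (bumpField B (e B)) x)) ^ 2) +
        512 * K₀ ^ 2 * κ * volume.real (Metric.ball B.1 B.2) := by
    intro B hB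
    obtain ⟨hR, hR1, -, -⟩ := hF B hB
    have h := (he B hB).2
    rw [volume_real_ball B.1 (show 0 < 2 * B.2 by linarith)] at h
    rw [volume_real_ball B.1 hR]
    set I := ∫ x in Metric.ball B.1 B.2, ‖ω ε t x‖
    set a := ∫ x, inner ℝ (u ε t x) (curl (bumpField B (e B)) x)
    have hI : 0 ≤ I := by positivity
    have hκ : 0 ≤ κ := by positivity
    calc c ^ 2 * (B.2⁻¹ * I ^ 2) = B.2⁻¹ * (c * I) ^ 2 := by ring
      _ ≤ B.2⁻¹ * (a + 2 * K₀ * ((2 * B.2) ^ 3 * κ)) ^ 2 := by gcongr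
      _ ≤ B.2⁻¹ * (2 * (a ^ 2 + (2 * K₀ * ((2 * B.2) ^ 3 * κ)) ^ 2)) := by
          gcongr
          exact add_sq_le
      _ = 2 * (B.2⁻¹ * a ^ 2) + 512 * K₀ ^ 2 * κ * (B.2 ^ 3 * κ) * B.2 ^ 2 := by
          field_simp
          ring
      _ ≤ _ := by
          refine add_le_add le_rfl ?_
          exact mul_le_of_le_one_right (by positivity) (pow_le_one₀ hR.le hR1)
  rw [le_div_iff₀ (by positivity), mul_comm, Finset.mul_sum]
  refine (Finset.sum_le_sum hterm).trans ?_
  rw [Finset.sum_add_distrib, ← Finset.mul_sum, ← Finset.mul_sum]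
  have h1 := hC ε hε t ht F e (fun B hB => ⟨(hF B hB).1, (hF B hB).2.2.2⟩)
    (fun B hB => (he B hB).1) hdisj
  have h2 := sum_volume_real_ball_le hK (fun B hB => (Metric.ball_subset_closedBall.trans
    (Metric.closedBall_subset_closedBall (by linarith [(hF B hB).1]))).trans (hF B hB).2.2.2) hdisj
  gcongr

/-- A compact set is covered by finitely many balls of radius at most `δ / 4`, and a single ball
is a packing, so the square sums over small balls yield a local `L¹` bound. -/
theorem exists_setIntegral_norm_vorticity_le (hT : 0 < T) (hu : IsApproxEuler T S u)
    (hω : ∀ ε ∈ S, ∀ t ∈ Icc 0 T, IsVorticity (u ε t) (ω ε t)) (hK₀ : 0 ≤ K₀) (hδ : 0 < δ)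
    (hθ : θ < 1)
    (halign : ∀ ε ∈ S, ∀ t ∈ Icc 0 T, ∀ᵐ z : Eu 3 × Eu 3,
      ‖z.1 - z.2‖ ≤ δ → K₀ < ‖ω ε t z.1‖ → K₀ < ‖ω ε t z.2‖ →
        ‖direction (ω ε t z.1) - direction (ω ε t z.2)‖ ≤ Real.sqrt 2 * θ)
    {K : Set (Eu 3)} (hK : IsCompact K) :
    ∃ C : ℝ, 0 ≤ C ∧ ∀ ε ∈ S, ∀ t ∈ Icc 0 T, ∫ x in K, ‖ω ε t x‖ ≤ C := by
  obtain ⟨C, hC0, hC⟩ := exists_sum_sq_vorticity_le_of_small hT hu hω hK₀ hθ halign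
    (hK.cthickening (r := 2))
  set r := min (δ / 4) 1
  have hr0 : 0 < r := lt_min (by positivity) one_pos
  have hr1 : r ≤ 1 := min_le_right _ _
  have hrδ : r ≤ δ / 4 := min_le_left _ _
  obtain ⟨s, hsK, hsfin, hs⟩ := hK.finite_cover_balls hr0
  lift s to Finset (Eu 3) using hsfin
  refine ⟨∑ x ∈ s, Real.sqrt (r * C), by positivity, fun ε hε t ht => ?_⟩
  have hint := (hω ε hε t ht).1
  have hball : ∀ x ∈ s, ∫ y in Metric.ball x r, ‖ω ε t y‖ ≤ Real.sqrt (r * C) := by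
    intro x hx
    have h := hC ε hε t ht {(x, r)} (by
      intro B hB
      rw [Finset.mem_singleton.1 hB]
      refine ⟨hr0, hr1, by linarith, ?_⟩
      exact (Metric.closedBall_subset_closedBall (by linarith)).trans
        (Metric.closedBall_subset_cthickening (hsK hx) 2)) (by simp)
    rw [Finset.sum_singleton, inv_mul_le_iff₀ hr0] at h
    exact Real.le_sqrt_of_sq_le h
  have hballint : ∀ x, IntegrableOn (fun y => ‖ω ε t y‖) (Metric.ball x r) := fun x =>
    ((hint.integrableOn_isCompact (isCompact_closedBall x r)).mono_set
      Metric.ball_subset_closedBall).norm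
  calc ∫ y in K, ‖ω ε t y‖ ≤ ∫ y, ‖ω ε t y‖ ∂(∑ x ∈ s, volume.restrict (Metric.ball x r)) := by
        refine integral_mono_measure ?_ (Eventually.of_forall fun _ => norm_nonneg _)
          (integrable_finsetSum_measure.2 fun x _ => hballint x)
        refine (Measure.restrict_mono hs le_rfl).trans ?_
        refine Measure.le_iff.2 fun A hA => ?_
        rw [Measure.restrict_apply hA, Measure.finsetSum_apply]
        simp_rw [Measure.restrict_apply hA, inter_iUnion₂]
        exact measure_biUnion_finset_le s fun x => A ∩ Metric.ball x r
    _ = ∑ x ∈ s, ∫ y in Metric.ball x r, ‖ω ε t y‖ :=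
        integral_finsetSum_measure fun x _ => hballint x
    _ ≤ _ := Finset.sum_le_sum hball

/-- The square sums over disjoint balls of radius at most `1` in a compact set. Alignment says
nothing on balls larger than `δ / 4`, but there `R⁻¹` is bounded and the local `L¹` bound
suffices. -/
theorem exists_sum_sq_vorticity_le (hT : 0 < T) (hu : IsApproxEuler T S u)
    (hω : ∀ ε ∈ S, ∀ t ∈ Icc 0 T, IsVorticity (u ε t) (ω ε t)) (halign : LocallyAligned T S ω)
    {K : Set (Eu 3)} (hK : IsCompact K) :
    ∃ C : ℝ, 0 ≤ C ∧ ∀ ε ∈ S, ∀ t ∈ Icc 0 T, ∀ F : Finset (Eu 3 × ℝ),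
      (∀ B ∈ F, 0 < B.2 ∧ B.2 ≤ 1 ∧ Metric.ball B.1 B.2 ⊆ K) →
      (F : Set (Eu 3 × ℝ)).PairwiseDisjoint (fun B => Metric.ball B.1 B.2) →
      ∑ B ∈ F, B.2⁻¹ * (∫ x in Metric.ball B.1 B.2, ‖ω ε t x‖) ^ 2 ≤ C := by
  classical
  obtain ⟨K₀, δ, θ, hK₀, hδ, hθ, halign⟩ := halign
  obtain ⟨C, hC0, hC⟩ := exists_sum_sq_vorticity_le_of_small hT hu hω hK₀ hθ halign
    (hK.cthickening (r := 2))
  obtain ⟨D, hD0, hD⟩ := exists_setIntegral_norm_vorticity_le hT hu hω hK₀ hδ hθ halign hK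
  refine ⟨C + 4 / δ * D ^ 2, by positivity, fun ε hε t ht F hF hdisj => ?_⟩
  rw [← Finset.sum_filter_add_sum_filter_not F fun B => 4 * B.2 ≤ δ]
  gcongr
  · refine hC ε hε t ht _ (fun B hB => ?_) (hdisj.subset (Finset.coe_subset.2
      (Finset.filter_subset _ F)))
    obtain ⟨hBF, hBδ⟩ := Finset.mem_filter.1 hB
    obtain ⟨h0, h1, hBK⟩ := hF B hBF
    exact ⟨h0, h1, hBδ, (Metric.closedBall_subset_closedBall (by linarith)).trans
      (Metric.closedBall_subset_cthickening (hBK (Metric.mem_ball_self h0)) 2)⟩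
  · have hnn : ∀ B : Eu 3 × ℝ, 0 ≤ ∫ x in Metric.ball B.1 B.2, ‖ω ε t x‖ := fun B => by positivity
    calc _ ≤ ∑ B ∈ F with ¬ 4 * B.2 ≤ δ,
          4 / δ * (∫ x in Metric.ball B.1 B.2, ‖ω ε t x‖) ^ 2 := by
          refine Finset.sum_le_sum fun B hB => ?_
          have h := (Finset.mem_filter.1 hB).2
          gcongr
          rw [inv_le_comm₀ (by linarith) (by positivity), inv_div]
          linarith
      _ ≤ ∑ B ∈ F, 4 / δ * (∫ x in Metric.ball B.1 B.2, ‖ω ε t x‖) ^ 2 :=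
          Finset.sum_le_sum_of_subset_of_nonneg (Finset.filter_subset _ F)
            fun B _ _ => by positivity
      _ ≤ 4 / δ * (∑ B ∈ F, ∫ x in Metric.ball B.1 B.2, ‖ω ε t x‖) ^ 2 := by
          rw [← Finset.mul_sum]
          gcongr
          exact Finset.sum_sq_le_sq_sum_of_nonneg fun B _ => hnn B
      _ ≤ 4 / δ * D ^ 2 := by
          have h1 := sum_setIntegral_norm_ball_le (hω ε hε t ht).1 hK
            (fun B hB => (hF B hB).2.2) hdisj
          have h2 : 0 ≤ ∑ B ∈ F, ∫ x in Metric.ball B.1 B.2, ‖ω ε t x‖ :=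
            Finset.sum_nonneg fun B _ => hnn B
          gcongr
          exact h1.trans (hD ε hε t ht)

end Vorticity

/-! ### The `V^{6/5,2}` norm of the vorticity -/

/-- For `N = 3` and `p = 6 / 5` the weight `R ^ (-N / p')` is `R ^ (-1 / 2)`, so the `V^{6/5,2}`
norm is governed by the finite sums of `R⁻¹ (∫ |w|)²`. -/
theorem vNorm_le_of_forall_finset {w : Eu 3 → Eu 3} (hw : LocallyIntegrable w) {R₀ C : ℝ}
    {Ω : Set (Eu 3)}
    (h : ∀ F : Finset (Eu 3 × ℝ),
      (∀ B ∈ F, 0 < B.2 ∧ B.2 ≤ R₀ ∧ Metric.ball B.1 B.2 ⊆ Ω) →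
      (F : Set (Eu 3 × ℝ)).PairwiseDisjoint (fun B => Metric.ball B.1 B.2) →
      ∑ B ∈ F, B.2⁻¹ * (∫ x in Metric.ball B.1 B.2, ‖w x‖) ^ 2 ≤ C) :
    vNorm (6 / 5) 2 R₀ Ω w ≤ (Real.sqrt C).toNNReal := by
  refine iSup₂_le fun 𝓑 h𝓑 => ?_
  have hC : 0 ≤ C := by simpa using h ∅ (by simp) (by simp)
  have hsqrt : ((Real.sqrt C).toNNReal : ℝ≥0∞) = ENNReal.ofReal C ^ (1 / (2 : ℝ)) := by
    rw [ENNReal.ofReal_rpow_of_nonneg hC (by norm_num), ← Real.sqrt_eq_rpow]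
    rfl
  rw [hsqrt]
  refine ENNReal.rpow_le_rpow ?_ (by norm_num)
  rw [ENNReal.tsum_eq_iSup_sum]
  refine iSup_le fun s => ?_
  have hterm : ∀ B : 𝓑, (ENNReal.ofReal (B.1.2 ^ (-(((3 : ℕ) : ℝ) * (1 - 1 / (6 / 5))))) *
      ∫⁻ x in Metric.ball B.1.1 B.1.2, ‖w x‖ₑ) ^ (2 : ℝ) =
      ENNReal.ofReal (B.1.2⁻¹ * (∫ x in Metric.ball B.1.1 B.1.2, ‖w x‖) ^ 2) := by
    intro B
    have hR := (h𝓑.1 B.1 B.2).1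
    have hint : IntegrableOn w (Metric.ball B.1.1 B.1.2) :=
      (hw.integrableOn_isCompact (isCompact_closedBall B.1.1 B.1.2)).mono_set
        Metric.ball_subset_closedBall
    rw [← ofReal_integral_norm_eq_lintegral_enorm hint, ← ENNReal.ofReal_mul (by positivity),
      ENNReal.ofReal_rpow_of_nonneg (by positivity) (by norm_num), Real.rpow_two, mul_pow,
      ← Real.rpow_natCast, ← Real.rpow_mul hR.le]
    norm_num [Real.rpow_neg_one]
  rw [Finset.sum_congr rfl fun B _ => hterm B,
    ← ENNReal.ofReal_sum_of_nonneg fun B _ => by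
      have := (h𝓑.1 B.1 B.2).1
      positivity]
  refine ENNReal.ofReal_le_ofReal ?_
  have hs := h (s.map (Function.Embedding.subtype _)) (by
      intro B hB
      obtain ⟨B', -, rfl⟩ := Finset.mem_map.1 hB
      exact h𝓑.1 _ B'.2)
    (h𝓑.2.subset (by
      intro B hB
      obtain ⟨B', -, rfl⟩ := Finset.mem_map.1 (Finset.mem_coe.1 hB)
      exact B'.2))
  rwa [Finset.sum_map] at hs

theorem memV_of_vNorm_le {N : ℕ} {w : Eu N → Eu N} (hw : LocallyIntegrable w) {p q R₀ : ℝ}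
    {Ω : Set (Eu N)} {C : ℝ≥0} (h : vNorm p q R₀ Ω w ≤ C) : MemV p q R₀ Ω w :=
  ⟨hw.locallyIntegrableOn Ω, h.trans_lt ENNReal.coe_lt_top⟩

theorem theorem4p2 (T : ℝ) (hT : 0 < T) (S : Set ℝ) (u ω : ℝ → ℝ → Eu 3 → Eu 3)
    (hu : IsApproxEuler T S u)
    (hω : ∀ ε ∈ S, ∀ t ∈ Icc 0 T, IsVorticity (u ε t) (ω ε t))
    (hsupp : ∀ ε ∈ S, ∀ t ∈ Icc 0 T, ∃ K, IsCompact K ∧ SupportedIn (ω ε t) K)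
    (halign : LocallyAligned T S ω)
    (R₀ : ℝ) (hR₀ : 0 < R₀) (hR₀' : R₀ < 1 / 2) :
    (∀ Ω : Set (Eu 3), IsOpen Ω → Bornology.IsBounded Ω →
      ∃ C : ℝ≥0, ∀ ε ∈ S, ∀ t ∈ Icc 0 T,
        MemV (6 / 5) 2 R₀ Ω (ω ε t) ∧ vNorm (6 / 5) 2 R₀ Ω (ω ε t) ≤ C) ∧
    ((∃ K, IsCompact K ∧ ∀ ε ∈ S, ∀ t ∈ Icc 0 T, SupportedIn (ω ε t) K) →
      ∃ C : ℝ≥0, ∀ Ω : Set (Eu 3), IsOpen Ω → ∀ ε ∈ S, ∀ t ∈ Icc 0 T,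
        MemV (6 / 5) 2 R₀ Ω (ω ε t) ∧ vNorm (6 / 5) 2 R₀ Ω (ω ε t) ≤ C) := by
  classical
  constructor
  · intro Ω _ hΩb
    obtain ⟨C, -, hC⟩ := exists_sum_sq_vorticity_le hT hu hω halign hΩb.isCompact_closure
    refine ⟨(Real.sqrt C).toNNReal, fun ε hε t ht => ?_⟩
    have hloc := (hω ε hε t ht).1
    have h := vNorm_le_of_forall_finset hloc (R₀ := R₀) (Ω := Ω) fun F hF hdisj =>
      hC ε hε t ht F (fun B hB => ⟨(hF B hB).1, by linarith [(hF B hB).2.1],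
        (hF B hB).2.2.trans subset_closure⟩) hdisj
    exact ⟨memV_of_vNorm_le hloc h, h⟩
  · rintro ⟨K, hK, hKω⟩
    obtain ⟨C, -, hC⟩ := exists_sum_sq_vorticity_le hT hu hω halign (hK.cthickening (r := 1))
    refine ⟨(Real.sqrt C).toNNReal, fun Ω _ ε hε t ht => ?_⟩
    have hloc := (hω ε hε t ht).1
    have h := vNorm_le_of_forall_finset hloc (R₀ := R₀) (Ω := Ω) fun F hF hdisj => by
      -- balls that miss `K` carry no vorticity, the others lie within distance `2 R₀ < 1` of `K`
      rw [← Finset.sum_filter_of_ne (p := fun B => (Metric.ball B.1 B.2 ∩ K).Nonempty)]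
      · refine hC ε hε t ht _ (fun B hB => ?_) (hdisj.subset (Finset.coe_subset.2
          (Finset.filter_subset _ F)))
        obtain ⟨hBF, y, hyB, hyK⟩ := Finset.mem_filter.1 hB
        refine ⟨(hF B hBF).1, by linarith [(hF B hBF).2.1], fun x hx => ?_⟩
        refine Metric.mem_cthickening_of_dist_le x y 1 K hyK ?_
        have := dist_triangle_right x y B.1
        linarith [Metric.mem_ball.1 hx, Metric.mem_ball.1 hyB, (hF B hBF).2.1]
      · intro B _ hne
        by_contra hemp
        refine hne ?_
        have h0 : ∫ x in Metric.ball B.1 B.2, ‖ω ε t x‖ = 0 := by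
          refine setIntegral_eq_zero_of_ae_eq_zero ?_
          filter_upwards [hKω ε hε t ht] with x hx hxB
          rw [hx fun hxK => hemp ⟨x, hxB, hxK⟩, norm_zero]
        rw [h0]
        ring
    exact ⟨memV_of_vNorm_le hloc h, h⟩
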